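/- Let $\mathcal P$ be the set of finite Borel measures on $\mathbb R$ with finite first moment. For $\chi\in\mathcal P$ put $P_\chi(k)=\int (k-z)^+\,\chi(dz)$, let $\alpha_\chi$ and $\beta_\chi$ be the infimum and supremum (in $[-\infty,\infty]$) of the support of $\chi$, let $I_\chi=\{z:\chi((-\infty,z])\,\chi([z,\infty))>0\}$, and for $0<u<\chi(\mathbb R)$ let $G_\chi(u)=\sup\{k:\chi((-\infty,k])<u\}$ and $\chi_u=\chi|_{(-\infty,G_\chi(u))}+\bigl(u-\chi((-\infty,G_\chi(u)))\bigr)\delta_{G_\chi(u)}$. Put $D_{\mu,\nu}=P_\nu-P_\mu$. Let $\mathcal K$ be the set of pairs $(\mu,\nu)$ with $\mu,\nu\in\mathcal P$, $\nu$ atom-free, $\mu\le_{cx}\nu$ (convex order) and $\{x:D_{\mu,\nu}(x)>0\}=I_\nu$. For $(\mu,\nu)\in\mathcal K$ and $0<u<\mu(\mathbb R)$ let $\mathcal E_{0,u}=P_\nu-P_{\mu_u}$, let $\mathcal E_{0,u}^c$ be its convex hull (the largest convex function below it), and let $$S(u)=\inf\{w\ge G_\mu(u):\mathcal E_{0,u}(w)=\mathcal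 E_{0,u}^c(w)\},\qquad \inf\emptyset=\infty ,$$ which is the upper function of the (quantile-lifted) left-curtain martingale coupling of $\mu$ and $\nu$. $\mathcal K_{SLC}$ is the set of $(\mu,\nu)\in\mathcal K$ for which there is $u_0\in(0,\mu(\mathbb R))$ with $S(u)=G_\mu(u)$ for all $u\in(0,u_0]$ and $S(u)>G_\mu(u+)$ for all $u\in(u_0,\mu(\mathbb R))$. $\mathcal K_R$ is the set of $(\mu,\nu)\in\mathcal K$, with $D=D_{\mu,\nu}$, such that: 1. There is $a\in\mathbb R$ with $\mu\le\nu$ on $(-\infty,a)$, and there is a largest such value $a_0\in\mathbb R$; with $u_0=\mu((-\infty,a_0))$ one has $G_\mu(u_0+)=a_0$. Let $a_1=\inf\{a<a_0:\mu=\nu\text{ on }(a,a_0)\}$, with $\inf\emptyset=a_0$. 2. The left derivative $D'(a_0-)$ exists and the tangent $L_{a_0}(k)=D(a_0)+(k-a_0)D'(a_0-)$ satisfies $D<L_{a_0}$ on $(a_0,\beta_\nu)$. 3. For every $b\in(\alpha_\nu,a_1)$, $D$ is differentiable at $b$, and for the tangent $L_b(k)=D(b)+(k-b)D'(b)$ there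 is $c>a_0$ such that $D>L_b$ on $(a_0,c)$, $D<L_b$ on $(c,\infty)$, and the left derivative $D'(c-)$ exists and satisfies $D'(b)>D'(c-)$. **Proposition.** $\mathcal K_{SLC}\subseteq\mathcal K_R$. -/

import Mathlib

open MeasureTheory Set

noncomputable section

namespace InjMart

/-- `χ ∈ 𝒫`: a finite measure on the line with finite first moment. -/
structure IsP (χ : Measure ℝ) : Prop where
  finite : IsFiniteMeasure χ
  integrable : Integrable (fun x : ℝ => x) χ

/-- The convex order on `𝒫`. A convex function is bounded below by an affine one, so its integral
against an element of `𝒫` is a real number or `+∞`; it suffices to test with the convex functions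
for which both integrals are real. -/
def ConvexOrder (μ ν : Measure ℝ) : Prop :=
  ∀ f : ℝ → ℝ, ConvexOn ℝ univ f → Integrable f μ → Integrable f ν →
    ∫ x, f x ∂μ ≤ ∫ x, f x ∂ν

/-- The put function `P_χ(k) = ∫ (k - z)⁺ χ(dz)`. -/
def putFn (χ : Measure ℝ) (k : ℝ) : ℝ := ∫ z, max (k - z) 0 ∂χ

/-- `D_{μ,ν} = P_ν - P_μ`. -/
def diffFn (μ ν : Measure ℝ) (k : ℝ) : ℝ := putFn ν k - putFn μ k

/-- `I_χ = {z : χ((-∞,z]) χ([z,∞)) > 0}`. -/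
def suppInterval (χ : Measure ℝ) : Set ℝ := {z | 0 < χ (Iic z) * χ (Ici z)}

/-- `α_χ`, the infimum of the support of `χ`, possibly `-∞`. -/
def lowerEnd (χ : Measure ℝ) : EReal := sInf ((fun x : ℝ => (x : EReal)) '' χ.support)

/-- `β_χ`, the supremum of the support of `χ`, possibly `+∞`. -/
def upperEnd (χ : Measure ℝ) : EReal := sSup ((fun x : ℝ => (x : EReal)) '' χ.support)

/-- The left-continuous quantile function `G_χ(u) = sup {k : χ((-∞,k]) < u}`; for
`0 < u < χ(ℝ)` the set is nonempty and bounded above. Its right limit at `u`, written `G_χ(u+)`,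
is `Function.rightLim (quantile χ) u`. -/
def quantile (χ : Measure ℝ) (u : ℝ) : ℝ := sSup {k : ℝ | χ.real (Iic k) < u}

/-- `χ_u`, the left-most part of `χ` of total mass `u`. -/
def leftPart (χ : Measure ℝ) (u : ℝ) : Measure ℝ :=
  χ.restrict (Iio (quantile χ u)) +
    (ENNReal.ofReal u - χ (Iio (quantile χ u))) • Measure.dirac (quantile χ u)

/-- `ℰ_{0,u} = P_ν - P_{μ_u}`. -/
def excess (μ ν : Measure ℝ) (u k : ℝ) : ℝ := putFn ν k - putFn (leftPart μ u) k

/-- The convex hull `H^c` of `H : ℝ → ℝ`: the largest convex function below `H`. -/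
def convHull (H : ℝ → ℝ) (x : ℝ) : ℝ :=
  sSup {y : ℝ | ∃ g : ℝ → ℝ, ConvexOn ℝ univ g ∧ (∀ z, g z ≤ H z) ∧ y = g x}

/-- `Z⁻_H(z) = inf {w ≥ z : H(w) = H^c(w)}`, with `inf ∅ = ∞`. -/
def contactAbove (H : ℝ → ℝ) (z : ℝ) : EReal :=
  sInf ((fun w : ℝ => (w : EReal)) '' {w : ℝ | z ≤ w ∧ H w = convHull H w})

/-- The upper function `S(u) = Z⁻_{ℰ_{0,u}}(G_μ(u))` of the lifted left-curtain martingale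
coupling of `μ` and `ν`. -/
def upperFn (μ ν : Measure ℝ) (u : ℝ) : EReal := contactAbove (excess μ ν u) (quantile μ u)

/-- Membership in `𝒦`. -/
structure IsK (μ ν : Measure ℝ) : Prop where
  left_mem : IsP μ
  right_mem : IsP ν
  noAtoms : ∀ x : ℝ, ν {x} = 0
  convexOrder : ConvexOrder μ ν
  irreducible : {x : ℝ | 0 < diffFn μ ν x} = suppInterval ν

/-- `𝒦_SLC`: the pairs in `𝒦` whose lifted left-curtain coupling is simple. -/
def classSLC : Set (Measure ℝ × Measure ℝ) :=
  {p | IsK p.1 p.2 ∧ ∃ u₀ : ℝ, 0 < u₀ ∧ u₀ < p.1.real univ ∧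
    (∀ u : ℝ, 0 < u → u ≤ u₀ → upperFn p.1 p.2 u = (quantile p.1 u : EReal)) ∧
    (∀ u : ℝ, u₀ < u → u < p.1.real univ →
      ((Function.rightLim (quantile p.1) u : ℝ) : EReal) < upperFn p.1 p.2 u)}

/-- `a₁ = inf {a : μ = ν on (a,a₀)}`, possibly `-∞`. Every `a ≥ a₀` belongs to the set, so the
infimum is `a₀` if no `a < a₀` does. -/
def equalityEnd (μ ν : Measure ℝ) (a₀ : ℝ) : EReal :=
  sInf ((fun a : ℝ => (a : EReal)) '' {a : ℝ | μ.restrict (Ioo a a₀) = ν.restrict (Ioo a a₀)})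

/-- `𝒦_R`. The tangent to `D` at `a₀` is taken with the left derivative of `D` there, since `D` has
a kink at `a₀` if `μ` has an atom at `a₀`. Derivatives enter through `HasDerivAt` and
`HasDerivWithinAt`, so that their existence is part of the conditions. -/
def classR : Set (Measure ℝ × Measure ℝ) :=
  {p | IsK p.1 p.2 ∧ ∃ a₀ : ℝ,
    -- `a₀` is the largest `a` such that `μ ≤ ν` on `(-∞,a)`; with `u₀ = μ((-∞,a₀))`,
    -- `G_μ(u₀+) = a₀`
    IsGreatest {a : ℝ | p.1.restrict (Iio a) ≤ p.2.restrict (Iio a)} a₀ ∧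
    Function.rightLim (quantile p.1) (p.1.real (Iio a₀)) = a₀ ∧
    -- the tangent at `a₀` lies strictly above `D` on `(a₀,β_ν)`
    (∃ s : ℝ, HasDerivWithinAt (diffFn p.1 p.2) s (Iio a₀) a₀ ∧
      ∀ k : ℝ, a₀ < k → (k : EReal) < upperEnd p.2 →
        diffFn p.1 p.2 k < diffFn p.1 p.2 a₀ + (k - a₀) * s) ∧
    -- the crossing condition for the tangent at each `b ∈ (α_ν,a₁)`
    (∀ b : ℝ, lowerEnd p.2 < (b : EReal) → (b : EReal) < equalityEnd p.1 p.2 a₀ →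
      ∃ s : ℝ, HasDerivAt (diffFn p.1 p.2) s b ∧
        ∃ c : ℝ, a₀ < c ∧
          (∀ k : ℝ, a₀ < k → k < c →
            diffFn p.1 p.2 b + (k - b) * s < diffFn p.1 p.2 k) ∧
          (∀ k : ℝ, c < k → diffFn p.1 p.2 k < diffFn p.1 p.2 b + (k - b) * s) ∧
          ∃ t : ℝ, HasDerivWithinAt (diffFn p.1 p.2) t (Iio c) c ∧ t < s)}

end InjMart

end

/-!
Let `m` be the common mass of `μ` and `ν` and let `D = D_{μ,ν}`. The left derivative of `D` at `x`
is `ν((-∞,x)) - μ((-∞,x))` (`leftSlope`), and the right derivative is smaller by `μ({x})`, so the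
kinks of `D` are concave. Say that `D` is supported from the left at `x` if it lies above its left
tangent at `x` on `(-∞,x]` (`LeftSupported`). The function `ℰ_{0,u}` equals `D` up to `G_μ(u)` and
is convex from there on, so the only obstruction to contact of `ℰ_{0,u}` with its convex hull lies
on the left, and the two halves of the definition of `𝒦_SLC` become statements about `D`:

* if `u ≤ u₀`, contact at `G_μ(u)` forces `u = μ((-∞,G_μ(u)))` and support from the left at
  `G_μ(u)` (`IsK.leftSupported_of_upperFn_eq`);
* if `u₀ < μ((-∞,g)) < m`, then `D` is not supported from the left at `g`, as otherwise `g` would be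
  a contact point in `[G_μ(u), G_μ(u+)]` for `u = μ((-∞,g))`
  (`IsK.upperFn_le_of_leftSupported`, `IsK.not_leftSupported`).

The first fact extends to the gaps of `μ`, so `D` is supported from the left on `(-∞,G_μ(u₀)]` and
smooth below `G_μ(u₀)`. Such a function is convex (`leftSlope_le_of_leftSupported`), which means
that `μ ≤ ν` there. Conversely, where `μ ≤ ν` holds `D` is convex, hence supported from the left, and
the second fact stops this at `a₀ = sup {x : μ((-∞,x)) ≤ u₀} = G_μ(u₀+)`
(`IsK.exists_turningPoint`).

Above `a₀`, the second fact says that no line of positive slope touches `D` at a point, staying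
below `D` to its left and slightly beyond (`IsK.false_of_line_le`). Consequently `D`, once above
such a line up to some `p ≥ a₀`, cannot cross it downwards and come back (`IsK.le_diffFn_of_le`).
Applied to the tangent at `a₀` this gives the strict inequality there (`IsK.diffFn_lt_tangent`);
applied to the tangent at `b < a₁`, which is strictly below `D` at `a₀` because `D` is steeper at
`a₀` than at `b`, it shows that the first crossing point after `a₀` is the only one
(`IsK.exists_crossing`). The slopes are positive since `D` vanishes at `-∞` and is positive on
`I_ν` (`IsK.leftSlope_pos`).
-/

open Filter Topology

namespace InjMart

/-! ### One-sided limits of distribution functions -/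

section DistributionFunction

variable {χ : Measure ℝ} [IsFiniteMeasure χ]

lemma exists_lt_real_Iic {k v : ℝ} (h : v < χ.real (Iio k)) : ∃ x < k, v < χ.real (Iic x) := by
  obtain ⟨s, hs, hsk, hst⟩ := exists_seq_strictMono_tendsto k
  have hU : ⋃ n, Iic (s n) = Iio k := iUnion_Iic_eq_Iio_of_lt_of_tendsto hsk hst
  have ht := tendsto_measure_iUnion_atTop (μ := χ) (s := fun n => Iic (s n))
    (fun i j hij => Iic_subset_Iic.2 (hs.monotone hij))
  rw [hU] at ht
  have ht' : Tendsto (fun n => χ.real (Iic (s n))) atTop (𝓝 (χ.real (Iio k))) :=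
    (ENNReal.tendsto_toReal (measure_ne_top _ _)).comp ht
  obtain ⟨n, hn⟩ := (ht'.eventually (lt_mem_nhds h)).exists
  exact ⟨s n, hsk n, hn⟩

lemma exists_gt_real_Iio {k v : ℝ} (h : χ.real (Iic k) < v) : ∃ x > k, χ.real (Iio x) < v := by
  obtain ⟨s, hs, hsk, hst⟩ := exists_seq_strictAnti_tendsto k
  have hI : ⋂ n, Iio (s n) = Iic k := by
    ext x
    simp only [mem_iInter, mem_Iio, mem_Iic]
    exact ⟨fun hx => ge_of_tendsto' hst fun n => (hx n).le, fun hx n => hx.trans_lt (hsk n)⟩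
  have ht := tendsto_measure_iInter_atTop (μ := χ) (s := fun n => Iio (s n))
    (fun n => measurableSet_Iio.nullMeasurableSet)
    (fun i j hij => Iio_subset_Iio (hs.antitone hij)) ⟨0, measure_ne_top _ _⟩
  rw [hI] at ht
  have ht' : Tendsto (fun n => χ.real (Iio (s n))) atTop (𝓝 (χ.real (Iic k))) :=
    (ENNReal.tendsto_toReal (measure_ne_top _ _)).comp ht
  obtain ⟨n, hn⟩ := (ht'.eventually (gt_mem_nhds h)).exists
  exact ⟨s n, hsk n, hn⟩

lemma exists_lt_real_Iic_of_lt_univ {v : ℝ} (h : v < χ.real univ) :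
    ∃ x, v < χ.real (Iic x) := by
  have ht : Tendsto (fun x => χ.real (Iic x)) atTop (𝓝 (χ.real univ)) :=
    (ENNReal.tendsto_toReal (measure_ne_top _ _)).comp (tendsto_measure_Iic_atTop χ)
  exact (ht.eventually (lt_mem_nhds h)).exists

lemma exists_real_Iic_lt {v : ℝ} (h : 0 < v) : ∃ x, χ.real (Iic x) < v := by
  have h1 := tendsto_measure_iInter_atTop (μ := χ) (s := fun n : ℕ => Iic (-(n : ℝ)))
    (fun n => measurableSet_Iic.nullMeasurableSet)
    (fun i j hij => Iic_subset_Iic.2 (neg_le_neg (Nat.cast_le.2 hij))) ⟨0, measure_ne_top _ _⟩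
  have hI : ⋂ n : ℕ, Iic (-(n : ℝ)) = ∅ := by
    ext x
    simp only [mem_iInter, mem_Iic, mem_empty_iff_false, iff_false, not_forall, not_le]
    obtain ⟨n, hn⟩ := exists_nat_gt (-x)
    exact ⟨n, by linarith⟩
  rw [hI, measure_empty] at h1
  have ht' : Tendsto (fun n : ℕ => χ.real (Iic (-(n : ℝ)))) atTop (𝓝 0) := by
    simpa using! (ENNReal.tendsto_toReal ENNReal.zero_ne_top).comp h1
  obtain ⟨n, hn⟩ := (ht'.eventually (gt_mem_nhds h)).exists
  exact ⟨_, hn⟩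

lemma real_Iic_eq_add (x : ℝ) : χ.real (Iic x) = χ.real (Iio x) + χ.real {x} := by
  rw [← Iio_union_right, measureReal_union (by simp) (measurableSet_singleton x)]

lemma real_Iio_le_real_Iic (x : ℝ) : χ.real (Iio x) ≤ χ.real (Iic x) :=
  measureReal_mono Iio_subset_Iic_self

lemma real_Iic_le_real_Iio {x y : ℝ} (h : x < y) : χ.real (Iic x) ≤ χ.real (Iio y) :=
  measureReal_mono (Iic_subset_Iio.2 h)

lemma real_Iio_mono {x y : ℝ} (h : x ≤ y) : χ.real (Iio x) ≤ χ.real (Iio y) :=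
  measureReal_mono (Iio_subset_Iio h)

lemma real_Iic_mono {x y : ℝ} (h : x ≤ y) : χ.real (Iic x) ≤ χ.real (Iic y) :=
  measureReal_mono (Iic_subset_Iic.2 h)

lemma real_Iio_le_univ (x : ℝ) : χ.real (Iio x) ≤ χ.real univ := measureReal_mono (subset_univ _)

lemma real_Iio_eq_add {x y : ℝ} (h : x ≤ y) :
    χ.real (Iio y) = χ.real (Iio x) + χ.real (Ico x y) := by
  rw [← measureReal_union _ measurableSet_Ico, Iio_union_Ico_eq_Iio h]
  rw [Set.disjoint_left]; intro z hz hz'; exact absurd hz'.1 (not_le.2 hz)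

end DistributionFunction

/-! ### Put functions -/

section PutFunction

variable {χ : Measure ℝ}

lemma IsP.integrable_max (hχ : IsP χ) (k : ℝ) : Integrable (fun z => max (k - z) 0) χ := by
  have := hχ.finite
  exact ((integrable_const k).sub hχ.integrable).pos_part

/-- The left derivative of `P_χ` at `y` is a subgradient there; no order of `x` and `y` is assumed. -/
lemma IsP.putFn_sub_le (hχ : IsP χ) (x y : ℝ) :
    putFn χ y - putFn χ x ≤ (y - x) * χ.real (Iio y) := by
  have := hχ.finite
  have hi : Integrable ((Iio y).indicator fun _ => y - x) χ :=
    (integrable_const _).indicator measurableSet_Iio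
  have h1 : ∫ z, (Iio y).indicator (fun _ => y - x) z ∂χ = (y - x) * χ.real (Iio y) := by
    rw [integral_indicator_const _ measurableSet_Iio, smul_eq_mul, mul_comm]
  rw [← h1, putFn, putFn, ← integral_sub (hχ.integrable_max y) (hχ.integrable_max x)]
  refine integral_mono ((hχ.integrable_max y).sub (hχ.integrable_max x)) hi fun z => ?_
  by_cases hz : z < y
  · simp only [indicator_of_mem (show z ∈ Iio y from hz), max_eq_left (by linarith : 0 ≤ y - z)]
    linarith [le_max_left (x - z) 0]
  · simp only [indicator_of_notMem (show z ∉ Iio y from hz),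
      max_eq_right (by linarith : y - z ≤ 0)]
    linarith [le_max_right (x - z) 0]

/-- The right derivative of `P_χ` at `x` is a subgradient there; no order of `x` and `y` is
assumed. -/
lemma IsP.le_putFn_sub (hχ : IsP χ) (x y : ℝ) :
    (y - x) * χ.real (Iic x) ≤ putFn χ y - putFn χ x := by
  have := hχ.finite
  have hi : Integrable ((Iic x).indicator fun _ => y - x) χ :=
    (integrable_const _).indicator measurableSet_Iic
  have h1 : ∫ z, (Iic x).indicator (fun _ => y - x) z ∂χ = (y - x) * χ.real (Iic x) := by
    rw [integral_indicator_const _ measurableSet_Iic, smul_eq_mul, mul_comm]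
  rw [← h1, putFn, putFn, ← integral_sub (hχ.integrable_max y) (hχ.integrable_max x)]
  refine integral_mono hi ((hχ.integrable_max y).sub (hχ.integrable_max x)) fun z => ?_
  by_cases hz : z ≤ x
  · simp only [indicator_of_mem (show z ∈ Iic x from hz), max_eq_left (by linarith : 0 ≤ x - z)]
    linarith [le_max_left (y - z) 0]
  · simp only [indicator_of_notMem (show z ∉ Iic x from hz),
      max_eq_right (by linarith : x - z ≤ 0)]
    linarith [le_max_right (y - z) 0]

lemma IsP.hasDerivWithinAt_putFn_left (hχ : IsP χ) (k : ℝ) :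
    HasDerivWithinAt (putFn χ) (χ.real (Iio k)) (Iio k) k := by
  have := hχ.finite
  rw [hasDerivWithinAt_iff_tendsto_slope' (by simp)]
  have hl : Tendsto (fun x => χ.real (Iic x)) (𝓝[<] k) (𝓝 (χ.real (Iio k))) := by
    refine tendsto_order.2 ⟨fun v hv => ?_, fun v hv => ?_⟩
    · obtain ⟨x, hx, hxv⟩ := exists_lt_real_Iic hv
      filter_upwards [Ioo_mem_nhdsLT hx] with y hy
      exact hxv.trans_le (real_Iic_mono hy.1.le)
    · filter_upwards [self_mem_nhdsWithin] with y hy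
      exact (real_Iic_le_real_Iio hy).trans_lt hv
  refine tendsto_of_tendsto_of_tendsto_of_le_of_le' hl tendsto_const_nhds ?_ ?_
  · filter_upwards [self_mem_nhdsWithin] with x hx
    have hx : x < k := hx
    rw [slope_comm, slope_def_field, le_div_iff₀ (by linarith), mul_comm]
    exact hχ.le_putFn_sub _ _
  · filter_upwards [self_mem_nhdsWithin] with x hx
    have hx : x < k := hx
    rw [slope_comm, slope_def_field, div_le_iff₀ (by linarith), mul_comm]
    exact hχ.putFn_sub_le _ _

lemma IsP.hasDerivWithinAt_putFn_right (hχ : IsP χ) (k : ℝ) :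
    HasDerivWithinAt (putFn χ) (χ.real (Iic k)) (Ioi k) k := by
  have := hχ.finite
  rw [hasDerivWithinAt_iff_tendsto_slope' (by simp)]
  have hl : Tendsto (fun x => χ.real (Iio x)) (𝓝[>] k) (𝓝 (χ.real (Iic k))) := by
    refine tendsto_order.2 ⟨fun v hv => ?_, fun v hv => ?_⟩
    · filter_upwards [self_mem_nhdsWithin] with y hy
      exact hv.trans_le (real_Iic_le_real_Iio hy)
    · obtain ⟨x, hx, hxv⟩ := exists_gt_real_Iio hv
      filter_upwards [Ioo_mem_nhdsGT hx] with y hy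
      exact (real_Iio_mono hy.2.le).trans_lt hxv
  refine tendsto_of_tendsto_of_tendsto_of_le_of_le' tendsto_const_nhds hl ?_ ?_
  · filter_upwards [self_mem_nhdsWithin] with x hx
    have hx : k < x := hx
    rw [slope_def_field, le_div_iff₀ (by linarith), mul_comm]
    exact hχ.le_putFn_sub _ _
  · filter_upwards [self_mem_nhdsWithin] with x hx
    have hx : k < x := hx
    rw [slope_def_field, div_le_iff₀ (by linarith), mul_comm]
    exact hχ.putFn_sub_le _ _

lemma IsP.continuous_putFn (hχ : IsP χ) : Continuous (putFn χ) := by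
  refine continuous_iff_continuousAt.2 fun k => continuousAt_iff_continuous_left'_right'.2 ?_
  exact ⟨(hχ.hasDerivWithinAt_putFn_left k).continuousWithinAt,
    (hχ.hasDerivWithinAt_putFn_right k).continuousWithinAt⟩

lemma IsP.tendsto_putFn_atBot (hχ : IsP χ) : Tendsto (putFn χ) atBot (𝓝 0) := by
  have := hχ.finite
  have h0 : (0 : ℝ) = ∫ z, (0 : ℝ) ∂χ := by simp
  rw [h0]
  refine tendsto_integral_filter_of_dominated_convergence (fun z => |z|) ?_ ?_
    hχ.integrable.abs ?_
  · exact Eventually.of_forall fun k => (hχ.integrable_max k).aestronglyMeasurable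
  · filter_upwards [eventually_le_atBot 0] with k hk
    refine Eventually.of_forall fun z => ?_
    rw [Real.norm_eq_abs, abs_of_nonneg (le_max_right _ _)]
    exact max_le (by linarith [neg_le_abs z]) (abs_nonneg z)
  · refine Eventually.of_forall fun z => tendsto_const_nhds.congr' ?_
    filter_upwards [eventually_le_atBot z] with k hk
    rw [max_eq_right (by linarith)]

lemma le_of_hasDerivWithinAt_Ioi {f : ℝ → ℝ} {x r σ f' : ℝ} (hf : HasDerivWithinAt f f' (Ioi x) x)
    (hr : x < r) (h : ∀ y, x < y → y < r → f x + σ * (y - x) ≤ f y) : σ ≤ f' := by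
  rw [hasDerivWithinAt_iff_tendsto_slope' (by simp)] at hf
  refine ge_of_tendsto hf ?_
  filter_upwards [Ioo_mem_nhdsGT hr] with y hy
  rw [slope_def_field, le_div_iff₀ (by linarith [hy.1])]
  linarith [h y hy.1 hy.2]

lemma le_of_hasDerivWithinAt_Iio {f : ℝ → ℝ} {x l σ f' : ℝ} (hf : HasDerivWithinAt f f' (Iio x) x)
    (hl : l < x) (h : ∀ y, l < y → y < x → f x + σ * (y - x) ≤ f y) : f' ≤ σ := by
  rw [hasDerivWithinAt_iff_tendsto_slope' (by simp)] at hf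
  refine le_of_tendsto hf ?_
  filter_upwards [Ioo_mem_nhdsLT hl] with y hy
  rw [slope_comm, slope_def_field, div_le_iff₀ (by linarith [hy.2])]
  linarith [h y hy.1 hy.2]

end PutFunction

/-! ### Comparison of measures on a half-line -/

section Comparison

variable {μ ν : Measure ℝ}

/-- The difference of the distribution functions is nondecreasing and right-continuous, and `ν` is
the sum of `μ` and the associated Stieltjes measure. -/
lemma measure_le_of_real_Ioc_le [IsFiniteMeasure μ] [IsFiniteMeasure ν]
    (h : ∀ x y, x ≤ y → μ.real (Ioc x y) ≤ ν.real (Ioc x y)) : μ ≤ ν := by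
  have hIoc : ∀ (χ : Measure ℝ) [IsFiniteMeasure χ] (x y : ℝ), x ≤ y →
      χ.real (Iic y) = χ.real (Iic x) + χ.real (Ioc x y) := by
    intro χ _ x y hxy
    rw [← measureReal_union _ measurableSet_Ioc, Iic_union_Ioc_eq_Iic hxy]
    exact Set.disjoint_left.2 fun z hz hz' => absurd hz'.1 (not_lt.2 hz)
  have hr : ∀ (χ : Measure ℝ) [IsFiniteMeasure χ] (x : ℝ),
      ContinuousWithinAt (fun y => χ.real (Iic y)) (Ici x) x := by
    intro χ _ x
    rw [← continuousWithinAt_Ioi_iff_Ici]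
    refine tendsto_order.2 ⟨fun v hv => ?_, fun v hv => ?_⟩
    · filter_upwards [self_mem_nhdsWithin] with y hy
      exact hv.trans_le (real_Iic_mono (le_of_lt hy))
    · obtain ⟨z, hz, hzv⟩ := exists_gt_real_Iio hv
      filter_upwards [Ioo_mem_nhdsGT hz] with y hy
      exact (real_Iic_le_real_Iio hy.2).trans_lt hzv
  let F : StieltjesFunction ℝ :=
    { toFun := fun x => ν.real (Iic x) - μ.real (Iic x)
      mono' := fun x y hxy => by
        have := h x y hxy
        have h1 := hIoc μ x y hxy
        have h2 := hIoc ν x y hxy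
        dsimp only
        linarith
      right_continuous' := fun x => (hr ν x).sub (hr μ x) }
  have hF : ∀ x, F x = ν.real (Iic x) - μ.real (Iic x) := fun x => rfl
  have hν : ν = μ + F.measure := by
    refine Measure.ext_of_Ioc _ _ fun x y hxy => ?_
    have h1 := hIoc μ x y hxy.le
    have h2 := hIoc ν x y hxy.le
    rw [Measure.add_apply, StieltjesFunction.measure_Ioc, ← ofReal_measureReal (μ := μ),
      ← ENNReal.ofReal_add measureReal_nonneg, ← ofReal_measureReal (μ := ν)]
    · congr 1
      rw [hF, hF]; linarith
    · have := h x y hxy.le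
      rw [hF, hF]; linarith
  rw [hν]
  exact Measure.le_add_right le_rfl

lemma integral_le_of_restrict_le {s : Set ℝ} {f : ℝ → ℝ} (h : μ.restrict s ≤ ν.restrict s)
    (hf : Integrable f ν) (h0 : ∀ z, 0 ≤ f z) (hs : ∀ z, z ∉ s → f z = 0) :
    ∫ z, f z ∂μ ≤ ∫ z, f z ∂ν := by
  rw [← setIntegral_eq_integral_of_forall_compl_eq_zero (μ := μ) hs,
    ← setIntegral_eq_integral_of_forall_compl_eq_zero (μ := ν) hs]
  exact integral_mono_measure h (Eventually.of_forall h0) hf.restrict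

lemma real_le_of_restrict_le [IsFiniteMeasure ν] {s t : Set ℝ}
    (h : μ.restrict s ≤ ν.restrict s) (ht : MeasurableSet t) (hts : t ⊆ s) :
    μ.real t ≤ ν.real t := by
  have h1 := h t
  rw [Measure.restrict_apply ht, Measure.restrict_apply ht, inter_eq_self_of_subset_left hts] at h1
  exact ENNReal.toReal_mono (measure_ne_top _ _) h1

lemma restrict_le_restrict_of_subset {s t : Set ℝ} (h : μ.restrict s ≤ ν.restrict s)
    (ht : MeasurableSet t) (hts : t ⊆ s) : μ.restrict t ≤ ν.restrict t := by
  have h1 := Measure.restrict_mono (subset_refl t) h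
  rwa [Measure.restrict_restrict ht, Measure.restrict_restrict ht,
    inter_eq_self_of_subset_left hts] at h1

end Comparison

/-! ### One-sided slopes and supporting lines of `D` -/

section Slope

variable {μ ν : Measure ℝ}

/-- `ν((-∞,x)) - μ((-∞,x))`, which is the left derivative of `D_{μ,ν}` at `x`. -/
def leftSlope (μ ν : Measure ℝ) (x : ℝ) : ℝ := ν.real (Iio x) - μ.real (Iio x)

/-- On `(-∞,x]` the function `D_{μ,ν}` lies above its tangent at `x`, taken with the left
derivative. -/
def LeftSupported (μ ν : Measure ℝ) (x : ℝ) : Prop :=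
  ∀ k ≤ x, diffFn μ ν x + (k - x) * leftSlope μ ν x ≤ diffFn μ ν k

/-- The inequality at `k` is the integral against `ν - μ` of the function
`(g - k) 1_{z < g} - ((g - z)⁺ - (k - z)⁺)`, which is nonnegative and vanishes on `[g,∞)`. -/
lemma leftSupported_of_restrict_le (hμ : IsP μ) (hν : IsP ν) {a g : ℝ}
    (h : μ.restrict (Iio a) ≤ ν.restrict (Iio a)) (hg : g ≤ a) : LeftSupported μ ν g := by
  have := hμ.finite
  have := hν.finite
  intro k hk
  let f : ℝ → ℝ := fun z =>
    (Iio g).indicator (fun _ => g - k) z - (max (g - z) 0 - max (k - z) 0)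
  have hfi : ∀ χ : Measure ℝ, IsP χ → Integrable f χ := fun χ hχ => by
    have := hχ.finite
    exact ((integrable_const _).indicator measurableSet_Iio).sub
      ((hχ.integrable_max g).sub (hχ.integrable_max k))
  have hf : ∀ χ : Measure ℝ, IsP χ →
      ∫ z, f z ∂χ = (g - k) * χ.real (Iio g) - (putFn χ g - putFn χ k) := fun χ hχ => by
    have := hχ.finite
    have hi : Integrable (fun z => max (g - z) 0 - max (k - z) 0) χ :=
      (hχ.integrable_max g).sub (hχ.integrable_max k)
    simp only [f]
    rw [integral_sub ((integrable_const _).indicator measurableSet_Iio) hi,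
      integral_sub (hχ.integrable_max g) (hχ.integrable_max k),
      integral_indicator_const _ measurableSet_Iio, smul_eq_mul, mul_comm, putFn, putFn]
  have key := integral_le_of_restrict_le (f := f) h (hfi ν hν) (fun z => ?_) (fun z hz => ?_)
  · rw [hf μ hμ, hf ν hν] at key
    simp only [diffFn, leftSlope]
    linarith
  · by_cases hz : z < g
    · simp only [f, indicator_of_mem (show z ∈ Iio g from hz),
        max_eq_left (by linarith : 0 ≤ g - z)]
      linarith [le_max_left (k - z) 0]
    · simp only [f, indicator_of_notMem (show z ∉ Iio g from hz),
        max_eq_right (by linarith : g - z ≤ 0)]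
      rw [max_eq_right (by linarith)]; simp
  · have hz' : g ≤ z := hg.trans (not_lt.1 hz)
    simp only [f, indicator_of_notMem (show z ∉ Iio g from not_lt.2 hz')]
    rw [max_eq_right (by linarith), max_eq_right (by linarith)]; simp

/-- The counterpart of `leftSupported_of_restrict_le` to the right of the point of tangency, with the
function `(x - z)⁺ - (b - z)⁺ - (x - b) 1_{z < b}`. -/
lemma diffFn_ge_of_restrict_le (hμ : IsP μ) (hν : IsP ν) {a b x : ℝ}
    (h : μ.restrict (Iio a) ≤ ν.restrict (Iio a)) (hbx : b ≤ x) (hx : x ≤ a) :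
    diffFn μ ν b + (x - b) * leftSlope μ ν b ≤ diffFn μ ν x := by
  have := hμ.finite
  have := hν.finite
  let f : ℝ → ℝ := fun z =>
    (max (x - z) 0 - max (b - z) 0) - (Iio b).indicator (fun _ => x - b) z
  have hfi : ∀ χ : Measure ℝ, IsP χ → Integrable f χ := fun χ hχ => by
    have := hχ.finite
    exact ((hχ.integrable_max x).sub (hχ.integrable_max b)).sub
      ((integrable_const _).indicator measurableSet_Iio)
  have hf : ∀ χ : Measure ℝ, IsP χ →
      ∫ z, f z ∂χ = (putFn χ x - putFn χ b) - (x - b) * χ.real (Iio b) := fun χ hχ => by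
    have := hχ.finite
    have hi : Integrable (fun z => max (x - z) 0 - max (b - z) 0) χ :=
      (hχ.integrable_max x).sub (hχ.integrable_max b)
    simp only [f]
    rw [integral_sub hi ((integrable_const _).indicator measurableSet_Iio),
      integral_sub (hχ.integrable_max x) (hχ.integrable_max b),
      integral_indicator_const _ measurableSet_Iio, smul_eq_mul, mul_comm, putFn, putFn]
  have key := integral_le_of_restrict_le (f := f) h (hfi ν hν) (fun z => ?_) (fun z hz => ?_)
  · rw [hf μ hμ, hf ν hν] at key
    simp only [diffFn, leftSlope]
    linarith
  · by_cases hz : z < b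
    · simp only [f, indicator_of_mem (show z ∈ Iio b from hz),
        max_eq_left (by linarith : 0 ≤ b - z)]
      linarith [le_max_left (x - z) 0]
    · simp only [f, indicator_of_notMem (show z ∉ Iio b from hz),
        max_eq_right (by linarith : b - z ≤ 0)]
      linarith [le_max_right (x - z) 0]
  · have hz' : a ≤ z := not_lt.1 hz
    simp only [f, indicator_of_notMem (show z ∉ Iio b from not_lt.2 (hbx.trans (hx.trans hz')))]
    rw [max_eq_right (by linarith), max_eq_right (by linarith)]; simp

lemma leftSlope_sub [IsFiniteMeasure μ] [IsFiniteMeasure ν] {x y : ℝ} (h : x ≤ y) :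
    leftSlope μ ν y - leftSlope μ ν x = ν.real (Ico x y) - μ.real (Ico x y) := by
  have h1 := real_Iio_eq_add (χ := μ) h
  have h2 := real_Iio_eq_add (χ := ν) h
  simp only [leftSlope]; linarith

lemma restrict_Iio_le_of_leftSlope_le [IsFiniteMeasure μ] [IsFiniteMeasure ν] {a : ℝ}
    (hμ : ∀ x < a, μ {x} = 0) (hν : ∀ x, ν {x} = 0)
    (h : ∀ x y, x ≤ y → y ≤ a → leftSlope μ ν x ≤ leftSlope μ ν y) :
    μ.restrict (Iio a) ≤ ν.restrict (Iio a) := by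
  have hIco : ∀ (χ : Measure ℝ), (∀ x < a, χ {x} = 0) → ∀ x y : ℝ,
      (χ.restrict (Iio a)).real (Ioc x y) = χ.real (Ico x (min y a)) := by
    intro χ hχ x y
    have : NullSingletonClass (χ.restrict (Iio a)) := ⟨fun z => by
      rw [Measure.restrict_apply (measurableSet_singleton z)]
      by_cases hz : z < a
      · exact measure_mono_null inter_subset_left (hχ z hz)
      · rw [singleton_inter_eq_empty.2 (show z ∉ Iio a from hz), measure_empty]⟩
    rw [← measureReal_congr (Ico_ae_eq_Ioc (μ := χ.restrict (Iio a)) (a := x) (b := y)),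
      measureReal_restrict_apply measurableSet_Ico, Ico_inter_Iio]
  refine measure_le_of_real_Ioc_le fun x y _ => ?_
  rw [hIco μ hμ, hIco ν fun x _ => hν x]
  rcases le_total x (min y a) with hxy | hxy
  · have h1 := h x (min y a) hxy (min_le_right _ _)
    have h2 := leftSlope_sub (μ := μ) (ν := ν) hxy
    linarith
  · simp [Ico_eq_empty (not_lt.2 hxy)]

lemma hasDerivWithinAt_diffFn_left (hμ : IsP μ) (hν : IsP ν) (x : ℝ) :
    HasDerivWithinAt (diffFn μ ν) (leftSlope μ ν x) (Iio x) x :=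
  (hν.hasDerivWithinAt_putFn_left x).sub (hμ.hasDerivWithinAt_putFn_left x)

lemma hasDerivWithinAt_diffFn_right (hμ : IsP μ) (hν : IsP ν) (h0 : ∀ x, ν {x} = 0) (x : ℝ) :
    HasDerivWithinAt (diffFn μ ν) (leftSlope μ ν x - μ.real {x}) (Ioi x) x := by
  have := hμ.finite
  have := hν.finite
  have h := (hν.hasDerivWithinAt_putFn_right x).sub (hμ.hasDerivWithinAt_putFn_right x)
  have h1 : ν.real {x} = 0 := by rw [measureReal_def, h0]; rfl
  have h2 : ν.real (Iic x) - μ.real (Iic x) = leftSlope μ ν x - μ.real {x} := by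
    rw [real_Iic_eq_add, real_Iic_eq_add, h1, leftSlope]; ring
  rw [h2] at h
  exact h

lemma hasDerivAt_diffFn (hμ : IsP μ) (hν : IsP ν) (h0 : ∀ x, ν {x} = 0) {x : ℝ}
    (hx : μ {x} = 0) : HasDerivAt (diffFn μ ν) (leftSlope μ ν x) x := by
  have h1 := hasDerivWithinAt_diffFn_left hμ hν x
  have h2 := hasDerivWithinAt_diffFn_right hμ hν h0 x
  rw [measureReal_def, hx, ENNReal.toReal_zero, sub_zero] at h2
  rw [← hasDerivWithinAt_univ, ← Iic_union_Ici (a := x)]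
  exact (hasDerivWithinAt_Iio_iff_Iic.1 h1).union (hasDerivWithinAt_Ioi_iff_Ici.1 h2)

lemma continuous_diffFn (hμ : IsP μ) (hν : IsP ν) : Continuous (diffFn μ ν) :=
  hν.continuous_putFn.sub hμ.continuous_putFn

lemma tendsto_diffFn_atBot (hμ : IsP μ) (hν : IsP ν) :
    Tendsto (diffFn μ ν) atBot (𝓝 0) := by
  simpa using! hν.tendsto_putFn_atBot.sub hμ.tendsto_putFn_atBot

/-- If `D` is supported from the left at every point below `a`, and smooth there, then for fixed
`k` the chord slope `(D(z) - D(k)) / (z - k)` is nondecreasing in `z`; hence so is the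
derivative of `D`. -/
lemma leftSlope_le_of_leftSupported (hμ : IsP μ) (hν : IsP ν) (h0 : ∀ x, ν {x} = 0) {a : ℝ}
    (ha : ∀ x < a, μ {x} = 0) (hs : ∀ x ≤ a, LeftSupported μ ν x) {x y : ℝ} (hxy : x ≤ y)
    (hy : y ≤ a) : leftSlope μ ν x ≤ leftSlope μ ν y := by
  rcases hxy.eq_or_lt with rfl | hxy
  · exact le_rfl
  set D := diffFn μ ν with hD
  have hd : ∀ z ∈ Ioo x y, HasDerivAt (slope D x)
      ((leftSlope μ ν z * (z - x) - (D z - D x) * 1) / (z - x) ^ 2) z := fun z hz => by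
    have h1 := ((hasDerivAt_diffFn hμ hν h0 (ha z (hz.2.trans_le hy))).sub_const (D x)).div
      ((hasDerivAt_id z).sub_const x) (sub_ne_zero.2 hz.1.ne')
    have h2 : slope D x = fun w => (D w - D x) / (w - x) := by
      ext w; rw [slope_def_field]
    rw [h2]; exact h1
  have hc : ContinuousOn (slope D x) (Ioc x y) := fun z hz => by
    refine ContinuousAt.continuousWithinAt ?_
    have h2 : slope D x = fun w => (D w - D x) / (w - x) := by
      ext w; rw [slope_def_field]
    rw [h2]
    exact ((continuous_diffFn hμ hν).continuousAt.sub continuousAt_const).div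
      (continuousAt_id.sub continuousAt_const) (sub_ne_zero.2 hz.1.ne')
  have hmono : MonotoneOn (slope D x) (Ioc x y) := by
    refine monotoneOn_of_deriv_nonneg (convex_Ioc x y) hc ?_ ?_ <;> rw [interior_Ioc]
    · exact fun z hz => (hd z hz).differentiableAt.differentiableWithinAt
    · intro z hz
      rw [(hd z hz).deriv]
      have := hs z (hz.2.le.trans hy) x hz.1.le
      refine div_nonneg ?_ (sq_nonneg _)
      linarith
  have h1 : leftSlope μ ν x ≤ slope D x y := by
    have ht := (hasDerivAt_diffFn hμ hν h0 (ha x (hxy.trans_le hy))).hasDerivWithinAt (s := Ioi x)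
    rw [hasDerivWithinAt_iff_tendsto_slope' (by simp)] at ht
    refine le_of_tendsto ht ?_
    filter_upwards [Ioo_mem_nhdsGT hxy] with z hz
    exact hmono ⟨hz.1, hz.2.le⟩ ⟨hxy, le_rfl⟩ hz.2.le
  refine h1.trans ?_
  rw [slope_def_field, div_le_iff₀ (by linarith)]
  linarith [hs y hy x hxy.le]

end Slope

/-! ### Consequences of membership in `𝒦` -/

section ClassK

variable {μ ν : Measure ℝ}

lemma IsK.real_univ_eq (h : IsK μ ν) : μ.real univ = ν.real univ := by
  have := h.left_mem.finite
  have := h.right_mem.finite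
  have h1 := h.convexOrder (fun _ => 1) (convexOn_const _ convex_univ) (integrable_const _)
    (integrable_const _)
  have h2 := h.convexOrder (fun _ => -1) (convexOn_const _ convex_univ) (integrable_const _)
    (integrable_const _)
  simp at h1 h2
  linarith

lemma IsK.mean_eq (h : IsK μ ν) : ∫ x, x ∂μ = ∫ x, x ∂ν := by
  have h1 := h.convexOrder (fun x => x) (convexOn_id convex_univ) h.left_mem.integrable
    h.right_mem.integrable
  have h2 := h.convexOrder (fun x => -x) (concaveOn_id convex_univ).neg h.left_mem.integrable.neg
    h.right_mem.integrable.neg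
  rw [integral_neg, integral_neg] at h2
  linarith

/-- As the masses and the means agree, `D(k) = ∫ (z - k)⁺ ν(dz) - ∫ (z - k)⁺ μ(dz)`, which is at most
`∫ |z| ν(dz)` for `k ≥ 0`. -/
lemma IsK.exists_diffFn_le (h : IsK μ ν) : ∃ C, ∀ k, 0 ≤ k → diffFn μ ν k ≤ C := by
  have := h.left_mem.finite
  have := h.right_mem.finite
  refine ⟨∫ z, |z| ∂ν, fun k hk => ?_⟩
  have h1 : k * μ.real univ - ∫ z, z ∂μ ≤ putFn μ k := by
    have : ∫ z, (k - z) ∂μ = k * μ.real univ - ∫ z, z ∂μ := by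
      rw [integral_sub (integrable_const k) h.left_mem.integrable]; simp [mul_comm]
    rw [← this]
    exact integral_mono ((integrable_const k).sub h.left_mem.integrable)
      (h.left_mem.integrable_max k) fun z => le_max_left _ _
  have h2 : putFn ν k ≤ k * ν.real univ - ∫ z, z ∂ν + ∫ z, |z| ∂ν := by
    have : ∫ z, ((k - z) + |z|) ∂ν = k * ν.real univ - ∫ z, z ∂ν + ∫ z, |z| ∂ν := by
      have hi : Integrable (fun z => k - z) ν := (integrable_const k).sub h.right_mem.integrable
      rw [integral_add hi h.right_mem.integrable.abs,
        integral_sub (integrable_const k) h.right_mem.integrable]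
      simp [mul_comm]
    rw [← this]
    refine integral_mono (h.right_mem.integrable_max k)
      (((integrable_const k).sub h.right_mem.integrable).add h.right_mem.integrable.abs)
      fun z => max_le ?_ ?_
    · dsimp only; linarith [abs_nonneg z]
    · dsimp only; linarith [le_abs_self z]
  rw [← h.real_univ_eq, ← h.mean_eq] at h2
  simp only [diffFn]; linarith

/-- A line supporting `D` from the left has positive slope at a point that lies strictly between
the ends of `ν`: `D` vanishes at `-∞`, which excludes a negative slope, and is positive on
`I_ν`, which excludes slope zero. -/
lemma IsK.leftSlope_pos (h : IsK μ ν) {x : ℝ} (hs : LeftSupported μ ν x)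
    (hν : 0 < ν.real (Iio x)) (hμ : μ.real (Iio x) < μ.real univ) : 0 < leftSlope μ ν x := by
  have := h.left_mem.finite
  have := h.right_mem.finite
  have ht := tendsto_diffFn_atBot h.left_mem h.right_mem
  rcases lt_trichotomy (leftSlope μ ν x) 0 with hneg | hzero | hpos
  · exfalso
    have h1 : Tendsto (fun k => diffFn μ ν x + (k - x) * leftSlope μ ν x) atBot atTop := by
      refine tendsto_atTop_add_const_left _ _ ?_
      exact (tendsto_atBot_add_const_right _ (-x) tendsto_id).atBot_mul_const_of_neg hneg
    have h2 : Tendsto (diffFn μ ν) atBot atTop := by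
      refine tendsto_atTop_mono' _ ?_ h1
      filter_upwards [eventually_le_atBot x] with k hk using hs k hk
    exact not_tendsto_atTop_of_tendsto_nhds ht h2
  · exfalso
    have hx : x ∈ suppInterval ν := by
      refine ENNReal.mul_pos ?_ ?_
      · intro h0
        have h1 := real_Iio_le_real_Iic (χ := ν) x
        rw [measureReal_def ν (Iic x), h0, ENNReal.toReal_zero] at h1
        linarith
      · intro h0
        have h1 : ν.real univ = ν.real (Iio x) := by
          have h2 := measureReal_union (μ := ν) (s₁ := Iio x) (s₂ := Ici x)
            (Set.disjoint_left.2 fun z hz hz' => absurd hz (not_lt.2 (mem_Ici.1 hz'))) measurableSet_Ici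
          rw [Iio_union_Ici, measureReal_def ν (Ici x), h0, ENNReal.toReal_zero, add_zero] at h2
          exact h2
        have h2 := h.real_univ_eq
        simp only [leftSlope] at hzero
        linarith
    rw [← h.irreducible] at hx
    have hx : 0 < diffFn μ ν x := hx
    have h1 : diffFn μ ν x ≤ 0 := by
      refine ge_of_tendsto ht ?_
      filter_upwards [eventually_le_atBot x] with k hk
      have := hs k hk
      rw [hzero] at this
      linarith
    linarith
  · exact hpos

end ClassK

/-! ### Quantile functions -/

section Quantile

variable {χ : Measure ℝ} [IsFiniteMeasure χ] {u x : ℝ}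

lemma real_Iic_lt_of_lt_quantile (hu : 0 < u) (h : x < quantile χ u) : χ.real (Iic x) < u := by
  obtain ⟨k, hk, hxk⟩ := exists_lt_of_lt_csSup (exists_real_Iic_lt hu) h
  exact (real_Iic_mono hxk.le).trans_lt hk

lemma quantile_le (hu : 0 < u) (h : u ≤ χ.real (Iic x)) : quantile χ u ≤ x := by
  refine csSup_le (exists_real_Iic_lt hu) fun k hk => ?_
  by_contra! hxk
  exact absurd (h.trans (real_Iic_mono hxk.le)) (not_le.2 hk)

lemma le_quantile (hu : u < χ.real univ) (h : ∀ k < x, χ.real (Iic k) < u) :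
    x ≤ quantile χ u := by
  obtain ⟨y, hy⟩ := exists_lt_real_Iic_of_lt_univ hu
  have hb : BddAbove {k : ℝ | χ.real (Iic k) < u} := ⟨y, fun k hk => by
    by_contra! hyk
    exact absurd (hy.le.trans (real_Iic_mono hyk.le)) (not_le.2 hk)⟩
  exact le_of_forall_lt fun k hk => by
    obtain ⟨z, hkz, hzx⟩ := exists_between hk
    exact hkz.trans_le (le_csSup hb (h z hzx))

lemma real_Iio_quantile_le (hu : 0 < u) : χ.real (Iio (quantile χ u)) ≤ u := by
  by_contra! h
  obtain ⟨x, hx, hux⟩ := exists_lt_real_Iic h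
  exact absurd (real_Iic_lt_of_lt_quantile hu hx) (not_lt.2 hux.le)

lemma le_real_Iic_quantile (hu : u < χ.real univ) : u ≤ χ.real (Iic (quantile χ u)) := by
  by_contra! h
  obtain ⟨x, hx, hxu⟩ := exists_gt_real_Iio h
  refine absurd (le_quantile hu (x := x) fun k hk => ?_) (not_le.2 hx)
  exact (real_Iic_le_real_Iio hk).trans_lt hxu

lemma quantile_mono {v : ℝ} (hu : 0 < u) (huv : u ≤ v) (hv : v < χ.real univ) :
    quantile χ u ≤ quantile χ v :=
  quantile_le hu (huv.trans (le_real_Iic_quantile hv))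

lemma rightLim_quantile_eq (hu : 0 < u) (hu' : u < χ.real univ) :
    Function.rightLim (quantile χ) u = sInf (quantile χ '' Ioo u (χ.real univ)) ∧
      BddBelow (quantile χ '' Ioo u (χ.real univ)) := by
  have hb : BddBelow (quantile χ '' Ioo u (χ.real univ)) := ⟨quantile χ u, by
    rintro _ ⟨v, hv, rfl⟩
    exact quantile_mono hu hv.1.le hv.2⟩
  have hm : MonotoneOn (quantile χ) (Ioo u (χ.real univ)) := fun v hv w hw hvw =>
    quantile_mono (hu.trans hv.1) hvw hw.2
  have ht := hm.tendsto_nhdsWithin_Ioo_right (nonempty_Ioo.2 hu') hb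
  exact ⟨rightLim_eq_of_tendsto ht, hb⟩

lemma rightLim_quantile_le {v : ℝ} (hu : 0 < u) (huv : u < v) (hv : v < χ.real univ) :
    Function.rightLim (quantile χ) u ≤ quantile χ v := by
  obtain ⟨h1, h2⟩ := rightLim_quantile_eq hu (huv.trans hv)
  rw [h1]
  exact csInf_le h2 ⟨v, ⟨huv, hv⟩, rfl⟩

lemma le_rightLim_quantile (hu : 0 < u) (hu' : u < χ.real univ) (h : χ.real (Iio x) ≤ u) :
    x ≤ Function.rightLim (quantile χ) u := by
  rw [(rightLim_quantile_eq hu hu').1]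
  refine le_csInf ((nonempty_Ioo.2 hu').image _) ?_
  rintro _ ⟨v, hv, rfl⟩
  exact le_quantile hv.2 fun k hk => ((real_Iic_le_real_Iio hk).trans h).trans_lt hv.1

end Quantile

/-! ### The left-most part of a measure -/

section LeftPart

variable {μ : Measure ℝ} {u : ℝ}

lemma leftPart_le [IsFiniteMeasure μ] (hu : u < μ.real univ) : leftPart μ u ≤ μ := by
  have h1 : ENNReal.ofReal u - μ (Iio (quantile μ u)) ≤ μ {quantile μ u} := by
    rw [tsub_le_iff_left, ← measure_union (by simp) (measurableSet_singleton _), Iio_union_right,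
      ← ofReal_measureReal]
    exact ENNReal.ofReal_le_ofReal (le_real_Iic_quantile hu)
  have h2 : (ENNReal.ofReal u - μ (Iio (quantile μ u))) • Measure.dirac (quantile μ u) ≤
      μ.restrict {quantile μ u} := by
    rw [Measure.restrict_singleton]
    intro s
    simp only [Measure.smul_apply, smul_eq_mul]
    gcongr
  calc leftPart μ u ≤ μ.restrict (Iio (quantile μ u)) + μ.restrict {quantile μ u} :=
        add_le_add le_rfl h2
    _ = μ.restrict (Iic (quantile μ u)) := by
        rw [← Measure.restrict_union (by simp) (measurableSet_singleton _), Iio_union_right]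
    _ ≤ μ := Measure.restrict_le_self

lemma IsP.leftPart (hμ : IsP μ) (hu : u < μ.real univ) : IsP (leftPart μ u) := by
  have := hμ.finite
  exact ⟨isFiniteMeasure_of_le μ (leftPart_le hu), hμ.integrable.mono_measure (leftPart_le hu)⟩

lemma leftPart_real_Iio (μ : Measure ℝ) (u : ℝ) :
    (leftPart μ u).real (Iio (quantile μ u)) = μ.real (Iio (quantile μ u)) := by
  simp [leftPart, measureReal_def]

lemma leftPart_real_Iic [IsFiniteMeasure μ] (hu : 0 < u) :
    (leftPart μ u).real (Iic (quantile μ u)) = u := by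
  have h1 : μ (Iio (quantile μ u)) ≤ ENNReal.ofReal u := by
    rw [← ofReal_measureReal]
    exact ENNReal.ofReal_le_ofReal (real_Iio_quantile_le hu)
  have h2 : leftPart μ u (Iic (quantile μ u)) = ENNReal.ofReal u := by
    rw [leftPart, Measure.add_apply, Measure.restrict_apply measurableSet_Iic,
      inter_eq_self_of_subset_right Iio_subset_Iic_self, Measure.smul_apply,
      Measure.dirac_apply_of_mem self_mem_Iic, smul_eq_mul, mul_one, add_tsub_cancel_of_le h1]
  rw [measureReal_def, h2, ENNReal.toReal_ofReal hu.le]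

lemma putFn_restrict_Iio {g k : ℝ} (hk : k ≤ g) : putFn (μ.restrict (Iio g)) k = putFn μ k := by
  rw [putFn, putFn]
  refine setIntegral_eq_integral_of_forall_compl_eq_zero fun z hz => ?_
  exact max_eq_right (by linarith [not_lt.1 (show ¬ z < g from hz)])

lemma putFn_leftPart (hμ : IsP μ) {k : ℝ} (hk : k ≤ quantile μ u) :
    putFn (leftPart μ u) k = putFn μ k := by
  have := hμ.finite
  rw [putFn, leftPart, integral_add_measure, integral_smul_measure, integral_dirac,
    max_eq_right (by linarith), smul_zero, add_zero]
  · exact putFn_restrict_Iio hk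
  · exact (hμ.integrable_max k).restrict
  · exact (integrable_dirac (by simp)).smul_measure
      (ne_top_of_le_ne_top ENNReal.ofReal_ne_top tsub_le_self)

/-- If `u = μ((-∞,g))`, then `G_μ(u) ≤ g`, and in case of strict inequality all the mass of `μ` at
`G_μ(u)` belongs to `μ_u` and `μ` does not charge `(G_μ(u),g)`. -/
lemma leftPart_eq_restrict_Iio [IsFiniteMeasure μ] {g : ℝ} (h0 : 0 < μ.real (Iio g))
    (hm : μ.real (Iio g) < μ.real univ) :
    leftPart μ (μ.real (Iio g)) = μ.restrict (Iio g) := by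
  set G := quantile μ (μ.real (Iio g)) with hG
  have hGg : G ≤ g := by
    by_contra! h
    exact absurd (real_Iic_lt_of_lt_quantile h0 h) (not_lt.2 (real_Iio_le_real_Iic g))
  rw [leftPart, ← hG, ofReal_measureReal]
  rcases hGg.eq_or_lt with h | h
  · rw [h]; simp
  · have h1 : μ.real (Iic G) = μ.real (Iio g) :=
      le_antisymm (real_Iic_le_real_Iio h) (le_real_Iic_quantile hm)
    have h1' : μ (Iic G) = μ (Iio g) := (measureReal_eq_measureReal_iff).1 h1
    have h2 : μ (Iio g) - μ (Iio G) = μ {G} := by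
      rw [← h1', ← Iio_union_right, measure_union (by simp) (measurableSet_singleton _)]
      exact ENNReal.add_sub_cancel_left (measure_ne_top _ _)
    rw [h2, ← Measure.restrict_singleton,
      ← Measure.restrict_union (by simp) (measurableSet_singleton _), Iio_union_right]
    exact Measure.restrict_congr_set (ae_eq_of_subset_of_measure_ge (Iic_subset_Iio.2 h) h1'.ge
      measurableSet_Iic.nullMeasurableSet (measure_ne_top _ _))

end LeftPart

/-! ### Contact of the excess function with its convex hull -/

section Contact

lemma chord_of_eq_convHull {H : ℝ → ℝ} (h0 : ∀ z, 0 ≤ H z) {x w y : ℝ} (hw : H w = convHull H w)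
    (hxw : x < w) (hwy : w < y) : H w * (y - x) ≤ (y - w) * H x + (w - x) * H y := by
  have hyx : 0 < y - x := by linarith
  rw [← le_div_iff₀ hyx, hw]
  refine csSup_le ⟨0, fun _ => 0, convexOn_const _ convex_univ, h0, rfl⟩ ?_
  rintro _ ⟨f, hf, hfH, rfl⟩
  rw [le_div_iff₀ hyx]
  have h1 := hf.2 (mem_univ x) (mem_univ y)
    (div_nonneg (by linarith) hyx.le : 0 ≤ (y - w) / (y - x))
    (div_nonneg (by linarith) hyx.le : 0 ≤ (w - x) / (y - x)) (by field_simp; ring)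
  have h2 : ((y - w) / (y - x)) • x + ((w - x) / (y - x)) • y = w := by
    simp only [smul_eq_mul]; field_simp; ring
  rw [h2] at h1
  simp only [smul_eq_mul] at h1
  have h3 : f w * (y - x) ≤ (y - w) * f x + (w - x) * f y := by
    calc f w * (y - x) ≤ ((y - w) / (y - x) * f x + (w - x) / (y - x) * f y) * (y - x) := by gcongr
      _ = _ := by field_simp
  have h4 : (y - w) * f x ≤ (y - w) * H x := by
    have := hfH x; gcongr
  have h5 : (w - x) * f y ≤ (w - x) * H y := by
    have := hfH y; gcongr
  linarith

lemma eq_convHull_of_line_le {H : ℝ → ℝ} {w s : ℝ} (h : ∀ k, H w + (k - w) * s ≤ H k) :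
    H w = convHull H w := by
  refine le_antisymm ?_ ?_
  · refine le_csSup ⟨H w, ?_⟩ ⟨fun k => H w + (k - w) * s, ?_, h, by simp⟩
    · rintro _ ⟨f, -, hf, rfl⟩
      exact hf w
    · refine ⟨convex_univ, fun x _ y _ a b _ _ hab => le_of_eq ?_⟩
      simp only [smul_eq_mul]
      linear_combination (-(H w) + w * s) * hab
  · refine csSup_le ⟨_, fun k => H w + (k - w) * s, ?_, h, rfl⟩ ?_
    · refine ⟨convex_univ, fun x _ y _ a b _ _ hab => le_of_eq ?_⟩
      simp only [smul_eq_mul]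
      linear_combination (-(H w) + w * s) * hab
    · rintro _ ⟨f, -, hf, rfl⟩
      exact hf w

variable {μ ν : Measure ℝ}

lemma IsK.diffFn_nonneg (h : IsK μ ν) (k : ℝ) : 0 ≤ diffFn μ ν k := by
  have h1 : ConvexOn ℝ univ fun z : ℝ => max (k - z) 0 :=
    (((convexOn_const k convex_univ).sub (concaveOn_id convex_univ))).sup
      (convexOn_const 0 convex_univ)
  exact sub_nonneg.2 (h.convexOrder _ h1 (h.left_mem.integrable_max k) (h.right_mem.integrable_max k))

lemma IsK.excess_nonneg (h : IsK μ ν) {u : ℝ} (hu : u < μ.real univ) (k : ℝ) :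
    0 ≤ excess μ ν u k := by
  have := h.left_mem.finite
  have h1 : putFn (leftPart μ u) k ≤ putFn μ k :=
    integral_mono_measure (leftPart_le hu) (Eventually.of_forall fun z => le_max_right _ _)
      (h.left_mem.integrable_max k)
  have h2 := h.diffFn_nonneg k
  simp only [diffFn] at h2
  simp only [excess]
  linarith

/-- If the upper function at `u` sits at its lowest possible value `G_μ(u)`, then `ℰ_{0,u}` has a
supporting line at `G_μ(u)`. Its slope is at most the right derivative `ν((-∞,G]) - u` and at
least the left derivative `ν((-∞,G)) - μ((-∞,G))`, so `u ≤ μ((-∞,G))`, and the line is the left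
tangent to `D`. -/
lemma IsK.leftSupported_of_upperFn_eq (h : IsK μ ν) {u : ℝ} (hu : 0 < u) (hum : u < μ.real univ)
    (hS : upperFn μ ν u = (quantile μ u : EReal)) :
    μ.real (Iio (quantile μ u)) = u ∧ LeftSupported μ ν (quantile μ u) := by
  have := h.left_mem.finite
  have := h.right_mem.finite
  set G := quantile μ u with hG
  set E := excess μ ν u with hE
  have hP := h.left_mem.leftPart hum
  have hEc : Continuous E := h.right_mem.continuous_putFn.sub hP.continuous_putFn
  have hEl : HasDerivWithinAt E (ν.real (Iio G) - μ.real (Iio G)) (Iio G) G := by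
    rw [← leftPart_real_Iio]
    exact (h.right_mem.hasDerivWithinAt_putFn_left G).sub (hP.hasDerivWithinAt_putFn_left G)
  have hEr : HasDerivWithinAt E (ν.real (Iio G) - u) (Ioi G) G := by
    have h1 := (h.right_mem.hasDerivWithinAt_putFn_right G).sub (hP.hasDerivWithinAt_putFn_right G)
    have h2 : ν.real {G} = 0 := by rw [measureReal_def, h.noAtoms]; rfl
    rw [leftPart_real_Iic hu, real_Iic_eq_add, h2, add_zero] at h1
    exact h1
  have hED : ∀ k ≤ G, E k = diffFn μ ν k := fun k hk => by
    simp only [hE, excess, diffFn, putFn_leftPart h.left_mem hk]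
  have hchord : ∀ x y, x < G → G < y → E G * (y - x) ≤ (y - G) * E x + (G - x) * E y := by
    intro x y hx hy
    have hcl : IsClosed {w | E w * (y - x) ≤ (y - w) * E x + (w - x) * E y} :=
      isClosed_le (by fun_prop) (by fun_prop)
    refine hcl.closure_subset (Metric.mem_closure_iff.2 fun ε hε => ?_)
    have hlt : upperFn μ ν u < ((min (G + ε) y : ℝ) : EReal) := by
      rw [hS, EReal.coe_lt_coe_iff]
      exact lt_min (by linarith) hy
    obtain ⟨_, ⟨w, ⟨hw1, hw2⟩, rfl⟩, hw⟩ := sInf_lt_iff.1 hlt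
    have hw3 := lt_min_iff.1 (EReal.coe_lt_coe_iff.1 hw)
    refine ⟨w, chord_of_eq_convHull (h.excess_nonneg hum) hw2 (hx.trans_le hw1) hw3.2, ?_⟩
    rw [dist_comm, Real.dist_eq, abs_of_nonneg (by linarith)]
    linarith [hw3.1]
  have hline : ∀ x < G, E G + (ν.real (Iio G) - u) * (x - G) ≤ E x := by
    intro x hx
    have h1 : (E G - E x) / (G - x) ≤ ν.real (Iio G) - u := by
      refine le_of_hasDerivWithinAt_Ioi hEr (lt_add_one G) fun y hy _ => ?_
      have h2 := hchord x y hx hy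
      have h3 : (E G - E x) / (G - x) * (y - G) ≤ E y - E G := by
        rw [div_mul_eq_mul_div, div_le_iff₀ (by linarith)]
        linarith
      linarith
    rw [div_le_iff₀ (by linarith)] at h1
    linarith
  have h1 := le_of_hasDerivWithinAt_Iio hEl (sub_one_lt G) fun y _ hy => hline y hy
  have h2 : μ.real (Iio G) = u := le_antisymm (real_Iio_quantile_le hu) (by linarith)
  refine ⟨h2, fun k hk => ?_⟩
  rcases hk.eq_or_lt with rfl | hk
  · simp
  · rw [← hED G le_rfl, ← hED k hk.le, leftSlope, h2, mul_comm]
    exact hline k hk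

/-- If `D` is supported from the left at `g` and `u = μ((-∞,g))`, then the left tangent to `D` at
`g` lies below `ℰ_{0,u}`, which is `D` on `(-∞,g]` and convex on `[g,∞)`. Hence `g`, which lies in
`[G_μ(u), G_μ(u+)]`, is a contact point. -/
lemma IsK.upperFn_le_of_leftSupported (h : IsK μ ν) {g : ℝ} (h0 : 0 < μ.real (Iio g))
    (hm : μ.real (Iio g) < μ.real univ) (hs : LeftSupported μ ν g) :
    upperFn μ ν (μ.real (Iio g)) ≤
      ((Function.rightLim (quantile μ) (μ.real (Iio g)) : ℝ) : EReal) := by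
  have := h.left_mem.finite
  have := h.right_mem.finite
  set E := excess μ ν (μ.real (Iio g)) with hE
  have hR : IsP (μ.restrict (Iio g)) := ⟨inferInstance, h.left_mem.integrable.restrict⟩
  have hEk : ∀ k, E k = putFn ν k - putFn (μ.restrict (Iio g)) k := fun k => by
    simp only [hE, excess, leftPart_eq_restrict_Iio h0 hm]
  have hED : ∀ k ≤ g, E k = diffFn μ ν k := fun k hk => by
    rw [hEk, putFn_restrict_Iio hk, diffFn]
  have hline : ∀ k, E g + (k - g) * leftSlope μ ν g ≤ E k := by
    intro k
    rcases le_total k g with hk | hk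
    · rw [hED g le_rfl, hED k hk]
      exact hs k hk
    · have h1 := h.right_mem.le_putFn_sub g k
      have h2 := hR.putFn_sub_le g k
      have h3 : (μ.restrict (Iio g)).real (Iio k) = μ.real (Iio g) := by
        rw [measureReal_restrict_apply measurableSet_Iio, Iio_inter_Iio, min_eq_right hk]
      have h4 := mul_le_mul_of_nonneg_left (real_Iio_le_real_Iic (χ := ν) g) (sub_nonneg.2 hk)
      rw [h3] at h2
      rw [hEk, hEk, leftSlope]
      linarith
  have hGg : quantile μ (μ.real (Iio g)) ≤ g := quantile_le h0 (real_Iio_le_real_Iic g)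
  calc upperFn μ ν (μ.real (Iio g)) ≤ (g : EReal) :=
        sInf_le ⟨g, ⟨hGg, eq_convHull_of_line_le hline⟩, rfl⟩
    _ ≤ _ := EReal.coe_le_coe_iff.2 (le_rightLim_quantile h0 hm le_rfl)

end Contact

/-! ### The turning point `a₀` -/

section TurningPoint

variable {μ ν : Measure ℝ} {u₀ : ℝ}

/-- Below `G_μ(u₀)` the function `D` is supported from the left at every point: at the values of
`G_μ` by the contact property, and in the gaps of `μ` because there `D` is a translate of `P_ν`
by an affine function. -/
lemma IsK.restrict_Iio_quantile_le (h : IsK μ ν) (hu₀ : 0 < u₀) (hum : u₀ < μ.real univ)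
    (hA : ∀ u, 0 < u → u ≤ u₀ → upperFn μ ν u = (quantile μ u : EReal)) :
    μ.restrict (Iio (quantile μ u₀)) ≤ ν.restrict (Iio (quantile μ u₀)) := by
  have := h.left_mem.finite
  have := h.right_mem.finite
  have key : ∀ u, 0 < u → u ≤ u₀ →
      μ.real (Iio (quantile μ u)) = u ∧ LeftSupported μ ν (quantile μ u) := fun u hu huu =>
    h.leftSupported_of_upperFn_eq hu (huu.trans_lt hum) (hA u hu huu)
  have hatom : ∀ x < quantile μ u₀, μ {x} = 0 := by
    intro x hx
    have h1 : μ.real (Iic x) ≤ μ.real (Iio x) := by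
      rcases (measureReal_nonneg (μ := μ) (s := Iic x)).eq_or_lt with h2 | h2
      · rw [← h2]; exact measureReal_nonneg
      · have h3 := key _ h2 (real_Iic_lt_of_lt_quantile hu₀ hx).le
        rw [← h3.1]
        exact real_Iio_mono (quantile_le h2 le_rfl)
    have h2 := real_Iic_eq_add (χ := μ) x
    have h3 : μ.real {x} = 0 := le_antisymm (by linarith) measureReal_nonneg
    exact (measureReal_eq_zero_iff).1 h3
  have hsupp : ∀ x ≤ quantile μ u₀, LeftSupported μ ν x := by
    intro x hx k hk
    have hν := h.right_mem.putFn_sub_le k x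
    rcases (measureReal_nonneg (μ := μ) (s := Iio x)).eq_or_lt with h0 | h0
    · have h1 := h.left_mem.le_putFn_sub k x
      have h2 : 0 ≤ (x - k) * μ.real (Iic k) := mul_nonneg (by linarith) measureReal_nonneg
      simp only [diffFn, leftSlope, ← h0]
      linarith
    · have hv : μ.real (Iio x) ≤ u₀ :=
        (real_Iio_mono hx).trans (real_Iio_quantile_le hu₀)
      obtain ⟨h1, h2⟩ := key _ h0 hv
      set y := quantile μ (μ.real (Iio x)) with hy
      have hyx : y ≤ x := quantile_le h0 (real_Iio_le_real_Iic x)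
      have hmid : ∀ z, y ≤ z → z ≤ x →
          diffFn μ ν x + (z - x) * leftSlope μ ν x ≤ diffFn μ ν z := by
        intro z hyz hzx
        have h3 := h.right_mem.putFn_sub_le z x
        have h4 := h.left_mem.le_putFn_sub z x
        have h5 : μ.real (Iio x) ≤ μ.real (Iic z) := by
          rw [← h1]; exact (real_Iio_mono hyz).trans (real_Iio_le_real_Iic z)
        have h6 := mul_le_mul_of_nonneg_left h5 (sub_nonneg.2 hzx)
        simp only [diffFn, leftSlope]
        linarith
      rcases le_total y k with hyk | hky
      · exact hmid k hyk hk
      · have h3 := h2 k hky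
        have h4 := hmid y le_rfl hyx
        have h5 : leftSlope μ ν y ≤ leftSlope μ ν x := by
          have := real_Iio_mono (χ := ν) hyx
          simp only [leftSlope]
          linarith
        have h6 := mul_le_mul_of_nonneg_left h5 (sub_nonneg.2 hky)
        linarith
  exact restrict_Iio_le_of_leftSlope_le hatom h.noAtoms fun x y hxy hy =>
    leftSlope_le_of_leftSupported h.left_mem h.right_mem h.noAtoms hatom hsupp hxy hy

lemma IsK.not_leftSupported (h : IsK μ ν) (hu₀ : 0 < u₀)
    (hB : ∀ u, u₀ < u → u < μ.real univ →
      ((Function.rightLim (quantile μ) u : ℝ) : EReal) < upperFn μ ν u) {g : ℝ}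
    (hg : u₀ < μ.real (Iio g)) (hg' : μ.real (Iio g) < μ.real univ) : ¬ LeftSupported μ ν g :=
  fun hs => absurd (h.upperFn_le_of_leftSupported (hu₀.trans hg) hg' hs) (not_le.2 (hB _ hg hg'))

lemma IsK.measure_singleton_eq_zero (h : IsK μ ν) {a x : ℝ}
    (hle : μ.restrict (Iio a) ≤ ν.restrict (Iio a)) (hx : x < a) : μ {x} = 0 := by
  have := h.left_mem.finite
  have := h.right_mem.finite
  have h1 := real_le_of_restrict_le hle (measurableSet_singleton x) (singleton_subset_iff.2 hx)
  rw [measureReal_def ν, h.noAtoms, ENNReal.toReal_zero] at h1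
  exact (measureReal_eq_zero_iff).1 (le_antisymm h1 measureReal_nonneg)

/-- If `μ ≤ ν` on `(-∞,a)` then `D` is supported from the left on `(-∞,a]` and `μ` has no atoms
there, so no level `u > u₀` can be reached in `(-∞,a)`. -/
lemma IsK.real_Iio_le_of_restrict_le (h : IsK μ ν) (hu₀ : 0 < u₀)
    (hB : ∀ u, u₀ < u → u < μ.real univ →
      ((Function.rightLim (quantile μ) u : ℝ) : EReal) < upperFn μ ν u) {a : ℝ}
    (hle : μ.restrict (Iio a) ≤ ν.restrict (Iio a)) : μ.real (Iio a) ≤ u₀ := by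
  have := h.left_mem.finite
  have := h.right_mem.finite
  by_contra! hua
  obtain ⟨v, hv1, hv2⟩ := exists_between hua
  have hvm := hv2.trans_le (real_Iio_le_univ a)
  have hv0 := hu₀.trans hv1
  set g := quantile μ v with hg
  have hga : g < a := by
    obtain ⟨x, hxa, hx⟩ := exists_lt_real_Iic hv2
    exact (quantile_le hv0 hx.le).trans_lt hxa
  have h1 : μ.real (Iio g) = v := by
    have h2 := real_Iic_eq_add (χ := μ) g
    have h3 : μ.real {g} = 0 := by
      rw [measureReal_def, h.measure_singleton_eq_zero hle hga]; rfl
    have h4 := le_real_Iic_quantile hvm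
    rw [← hg] at h4
    exact le_antisymm (real_Iio_quantile_le hv0) (by linarith)
  exact h.not_leftSupported hu₀ hB (by rw [h1]; exact hv1) (by rw [h1]; exact hvm)
    (leftSupported_of_restrict_le h.left_mem h.right_mem hle hga.le)

/-- The turning point is `a₀ = sup {x : μ((-∞,x)) ≤ u₀}`. It is at least `G_μ(u₀)`, and `μ` has no
mass in between, so `μ ≤ ν` extends from `(-∞,G_μ(u₀))` to `(-∞,a₀)`. -/
lemma IsK.exists_turningPoint (h : IsK μ ν) (hu₀ : 0 < u₀) (hum : u₀ < μ.real univ)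
    (hA : ∀ u, 0 < u → u ≤ u₀ → upperFn μ ν u = (quantile μ u : EReal))
    (hB : ∀ u, u₀ < u → u < μ.real univ →
      ((Function.rightLim (quantile μ) u : ℝ) : EReal) < upperFn μ ν u) :
    ∃ a₀, IsGreatest {a : ℝ | μ.restrict (Iio a) ≤ ν.restrict (Iio a)} a₀ ∧
      μ.real (Iio a₀) = u₀ ∧ Function.rightLim (quantile μ) u₀ = a₀ ∧
      ∀ x, a₀ < x → u₀ < μ.real (Iio x) := by
  have := h.left_mem.finite
  have := h.right_mem.finite
  have hG := (h.leftSupported_of_upperFn_eq hu₀ hum (hA u₀ hu₀ le_rfl)).1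
  have hGle := h.restrict_Iio_quantile_le hu₀ hum hA
  set G := quantile μ u₀
  obtain ⟨y, hy⟩ := exists_lt_real_Iic_of_lt_univ hum
  have hb : BddAbove {x : ℝ | μ.real (Iio x) ≤ u₀} := ⟨y, fun x hx => by
    by_contra! hyx
    exact absurd (hy.trans_le (real_Iic_le_real_Iio hyx)) (not_lt.2 hx)⟩
  have hne : {x : ℝ | μ.real (Iio x) ≤ u₀}.Nonempty := ⟨G, hG.le⟩
  set a₀ := sSup {x : ℝ | μ.real (Iio x) ≤ u₀} with ha₀
  have hlt : ∀ x, a₀ < x → u₀ < μ.real (Iio x) := fun x hx => by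
    by_contra! hxu
    exact absurd (le_csSup hb hxu) (not_le.2 hx)
  have hGa : G ≤ a₀ := le_csSup hb hG.le
  have ha : μ.real (Iio a₀) = u₀ := by
    refine le_antisymm ?_ (hG.symm.le.trans (real_Iio_mono hGa))
    by_contra! hua
    obtain ⟨x, hx, hxu⟩ := exists_lt_real_Iic hua
    obtain ⟨z, hz, hxz⟩ := exists_lt_of_lt_csSup hne hx
    exact absurd (hxu.trans_le (real_Iic_le_real_Iio hxz)) (not_lt.2 hz)
  refine ⟨a₀, ⟨?_, fun a hle => ?_⟩, ha, le_antisymm ?_ ?_, hlt⟩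
  · have h1 : (Iio G : Set ℝ) =ᵐ[μ] Iio a₀ := by
      refine ae_eq_of_subset_of_measure_ge (Iio_subset_Iio hGa) ?_
        measurableSet_Iio.nullMeasurableSet (measure_ne_top _ _)
      exact ((measureReal_eq_measureReal_iff).1 (ha.trans hG.symm)).le
    have h2 : μ.restrict (Iio a₀) ≤ ν.restrict (Iio a₀) := by
      rw [← Measure.restrict_congr_set h1]
      exact hGle.trans (Measure.restrict_mono (Iio_subset_Iio hGa) le_rfl)
    exact h2
  · exact le_csSup hb (h.real_Iio_le_of_restrict_le hu₀ hB hle)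
  · refine le_of_forall_gt_imp_ge_of_dense fun x hx => ?_
    obtain ⟨v, hv1, hv2⟩ := exists_between (hlt x hx)
    exact (rightLim_quantile_le hu₀ hv1 (hv2.trans_le (real_Iio_le_univ x))).trans
      (quantile_le (hu₀.trans hv1) (hv2.le.trans (real_Iio_le_real_Iic x)))
  · exact le_rightLim_quantile hu₀ hum ha.le

end TurningPoint

/-! ### Tangents to `D` and its shape above `a₀` -/

section Tangents

variable {μ ν : Measure ℝ} {a₀ : ℝ}

/-- Above `a₀`, no line of positive slope touches `D` at `m` while staying below `D` up to some
`r > m`: the kinks of `D` are concave, so `D` is differentiable at `m` with the slope of the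
line, and `D` would be supported from the left at `m`. -/
lemma IsK.false_of_line_le (h : IsK μ ν)
    (hS : ∀ g, a₀ < g → 0 < leftSlope μ ν g → ¬ LeftSupported μ ν g) {m r σ : ℝ} (hm : a₀ < m)
    (hr : m < r) (hσ : 0 < σ) (hl : ∀ x < r, diffFn μ ν m + σ * (x - m) ≤ diffFn μ ν x) :
    False := by
  have h1 := le_of_hasDerivWithinAt_Iio (hasDerivWithinAt_diffFn_left h.left_mem h.right_mem m)
    (sub_one_lt m) fun y _ hy => hl y (hy.trans hr)
  have h2 := le_of_hasDerivWithinAt_Ioi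
    (hasDerivWithinAt_diffFn_right h.left_mem h.right_mem h.noAtoms m) hr fun y _ hy => hl y hy
  have h3 : 0 ≤ μ.real {m} := measureReal_nonneg
  have h4 : leftSlope μ ν m = σ := by linarith
  refine hS m hm (h4 ▸ hσ) fun k hk => ?_
  have := hl k (hk.trans_lt hr)
  rw [h4]; linarith

/-- If `D` is at least a line of slope `s > 0` on `(-∞,p]`, it cannot dip strictly below that line
after `p` and return: at the lowest point relative to the line, a parallel line would touch `D`
from below. -/
lemma IsK.le_diffFn_of_le (h : IsK μ ν)
    (hS : ∀ g, a₀ < g → 0 < leftSlope μ ν g → ¬ LeftSupported μ ν g) {p q s d : ℝ} (hp : a₀ ≤ p)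
    (hs : 0 < s) (hleft : ∀ x ≤ p, d + s * x ≤ diffFn μ ν x) (hq : d + s * q ≤ diffFn μ ν q)
    {x : ℝ} (hx : x ≤ q) : d + s * x ≤ diffFn μ ν x := by
  rcases le_total x p with hxp | hpx
  · exact hleft x hxp
  by_contra! hlt
  have hc : ContinuousOn (fun z => diffFn μ ν z - s * z) (Icc p q) :=
    ((continuous_diffFn h.left_mem h.right_mem).sub (continuous_const.mul continuous_id)).continuousOn
  obtain ⟨m, hm, hmin⟩ := isCompact_Icc.exists_isMinOn ⟨x, hpx, hx⟩ hc
  have hmd : diffFn μ ν m - s * m < d := by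
    have := hmin (a := x) ⟨hpx, hx⟩
    simp only [mem_ofPred_eq] at this
    linarith
  have hpm : p < m := hm.1.lt_of_ne fun hpm => by
    have := hleft p le_rfl
    rw [← hpm] at hmd; linarith
  have hmq : m < q := hm.2.lt_of_ne fun hmq => by
    rw [hmq] at hmd; linarith
  refine h.false_of_line_le hS (hp.trans_lt hpm) hmq hs fun z hz => ?_
  rcases le_total z p with hzp | hpz
  · have := hleft z hzp
    linarith
  · have := hmin (a := z) ⟨hpz, hz.le⟩
    simp only [mem_ofPred_eq] at this
    linarith

/-- If `D` reached the left tangent at `a₀` again at some `k > a₀`, it would lie above that tangent on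
`(-∞,k]`. For `q` between `a₀` and `k` it would also lie above the chord over `[a₀,q]`, so the right
derivative at `a₀`, which is at most the left one, would be at least the slope of the chord. Then
`q` lies on the tangent, which touches `D` from below at `q`. -/
lemma IsK.diffFn_lt_tangent (h : IsK μ ν) (hle : LeftSupported μ ν a₀)
    (hpos : 0 < leftSlope μ ν a₀)
    (hS : ∀ g, a₀ < g → 0 < leftSlope μ ν g → ¬ LeftSupported μ ν g) {k : ℝ} (hk : a₀ < k) :
    diffFn μ ν k < diffFn μ ν a₀ + (k - a₀) * leftSlope μ ν a₀ := by
  by_contra! hlt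
  set s := leftSlope μ ν a₀ with hs
  set D := diffFn μ ν with hD
  have h1 : ∀ x ≤ k, (D a₀ - s * a₀) + s * x ≤ D x := fun x hx => by
    refine h.le_diffFn_of_le hS le_rfl hpos (fun x hx => ?_) ?_ hx
    · have := hle x hx
      linarith
    · linarith
  obtain ⟨q, hq1, hq2⟩ := exists_between hk
  -- The chord over `[a₀,q]` is steeper than the tangent by `t`.
  set t := (D q - D a₀) / (q - a₀) - s with ht
  have hqe : D q = D a₀ + (s + t) * (q - a₀) := by
    have : q - a₀ ≠ 0 := by linarith
    rw [ht]; field_simp; ring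
  have ht0 : 0 ≤ t := by
    have h2 := h1 q hq2.le
    rw [hqe] at h2
    have h3 : 0 ≤ t * (q - a₀) := by linarith
    exact nonneg_of_mul_nonneg_left h3 (by linarith)
  have h2 : ∀ x ≤ q, (D a₀ - (s + t) * a₀) + (s + t) * x ≤ D x := fun x hx => by
    refine h.le_diffFn_of_le hS le_rfl (by linarith) (fun x hx => ?_) ?_ hx
    · have h3 := hle x hx
      have h4 := mul_nonneg ht0 (sub_nonneg.2 hx)
      linarith
    · linarith
  have h3 := le_of_hasDerivWithinAt_Ioi (σ := s + t)
    (hasDerivWithinAt_diffFn_right h.left_mem h.right_mem h.noAtoms a₀) hq1 fun y _ hy => by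
      have := h2 y hy.le
      linarith
  have h4 : 0 ≤ μ.real {a₀} := measureReal_nonneg
  have h5 : t = 0 := by linarith
  rw [h5, add_zero] at hqe
  exact h.false_of_line_le hS hq1 hq2 hpos fun x hx => by
    have := h1 x hx.le
    rw [← hD]
    linarith

/-- On `(-∞,a₀)` the left slope of `D` is the distribution function of `ν - μ ≥ 0`; if it takes the
same value at `b` and `a₀`, then `μ = ν` on `(b,a₀)`. -/
lemma IsK.leftSlope_lt_of_lt_equalityEnd (h : IsK μ ν)
    (hle : μ.restrict (Iio a₀) ≤ ν.restrict (Iio a₀)) {b : ℝ}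
    (hb : (b : EReal) < equalityEnd μ ν a₀) : b < a₀ ∧ leftSlope μ ν b < leftSlope μ ν a₀ := by
  have := h.left_mem.finite
  have := h.right_mem.finite
  have hba : b < a₀ := by
    refine EReal.coe_lt_coe_iff.1 (hb.trans_le (sInf_le ⟨a₀, ?_, rfl⟩))
    simp
  refine ⟨hba, ?_⟩
  by_contra! hge
  suffices hmem : μ.restrict (Ioo b a₀) = ν.restrict (Ioo b a₀) from
    not_le.2 hb (sInf_le ⟨b, hmem, rfl⟩)
  have h1 := leftSlope_sub (μ := μ) (ν := ν) hba.le
  have h2 : μ.restrict (Ico b a₀) ≤ ν.restrict (Ico b a₀) :=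
    restrict_le_restrict_of_subset hle measurableSet_Ico Ico_subset_Iio_self
  have h3 : μ.restrict (Ico b a₀) = ν.restrict (Ico b a₀) := by
    refine Measure.eq_of_le_of_measure_univ_eq h2 ?_
    rw [Measure.restrict_apply_univ, Measure.restrict_apply_univ]
    refine (measureReal_eq_measureReal_iff).1 (le_antisymm ?_ (by linarith))
    exact real_le_of_restrict_le h2 measurableSet_Ico le_rfl
  have h4 := congrArg (fun χ => χ.restrict (Ioo b a₀)) h3
  simp only [Measure.restrict_restrict measurableSet_Ioo,
    inter_eq_self_of_subset_left (Ioo_subset_Ico_self (a := b) (b := a₀))] at h4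
  exact h4

/-- The tangent at `b` lies strictly below `D` at `a₀`, where `D` is steeper, and above `D` far to
the right, where `D` is bounded. Its first crossing point `c` after `a₀` is transversal, since
otherwise `D` would be supported from the left at `c`; and `D` cannot return to the tangent. -/
lemma IsK.exists_crossing (h : IsK μ ν)
    (hle : μ.restrict (Iio a₀) ≤ ν.restrict (Iio a₀))
    (hS : ∀ g, a₀ < g → 0 < leftSlope μ ν g → ¬ LeftSupported μ ν g) {b : ℝ} (hba : b < a₀)
    (hlt : leftSlope μ ν b < leftSlope μ ν a₀)
    (hpos : 0 < leftSlope μ ν b) :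
    ∃ c, a₀ < c ∧
      (∀ k, a₀ < k → k < c → diffFn μ ν b + (k - b) * leftSlope μ ν b < diffFn μ ν k) ∧
      (∀ k, c < k → diffFn μ ν k < diffFn μ ν b + (k - b) * leftSlope μ ν b) ∧
      leftSlope μ ν c < leftSlope μ ν b := by
  set s := leftSlope μ ν b with hs
  set D := diffFn μ ν with hD
  set H : ℝ → ℝ := fun k => D k - (D b + (k - b) * s) with hH
  have hDc : Continuous D := continuous_diffFn h.left_mem h.right_mem
  have hHc : Continuous H := by fun_prop
  have hH0 : ∀ x ≤ a₀, 0 ≤ H x := fun x hx => by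
    simp only [hH]
    rcases le_total x b with hxb | hbx
    · linarith [leftSupported_of_restrict_le h.left_mem h.right_mem hle hba.le x hxb]
    · linarith [diffFn_ge_of_restrict_le h.left_mem h.right_mem hle hbx hx]
  have hHa : 0 < H a₀ := by
    refine (hH0 a₀ le_rfl).lt_of_ne fun h0 => absurd hlt (not_lt.2 ?_)
    refine le_of_hasDerivWithinAt_Iio (hasDerivWithinAt_diffFn_left h.left_mem h.right_mem a₀)
      hba fun y _ hy => ?_
    have h1 := hH0 y hy.le
    simp only [hH] at h0 h1
    rw [← hD]
    linarith
  obtain ⟨k₁, hk₁, hk₁H⟩ : ∃ k, a₀ < k ∧ H k ≤ 0 := by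
    obtain ⟨C, hC⟩ := h.exists_diffFn_le
    refine ⟨max (max 0 (a₀ + 1)) (b + (C - D b) / s), ?_, ?_⟩
    · exact (lt_add_one a₀).trans_le ((le_max_right _ _).trans (le_max_left _ _))
    · have h1 := hC _ ((le_max_left 0 (a₀ + 1)).trans (le_max_left _ (b + (C - D b) / s)))
      have h2 := le_max_right (max 0 (a₀ + 1)) (b + (C - D b) / s)
      rw [← le_sub_iff_add_le', div_le_iff₀ hpos] at h2
      simp only [hH, hD]
      linarith
  -- the first zero of `H` above `a₀`
  set Z := {k | a₀ ≤ k ∧ H k ≤ 0} with hZ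
  have hZc : IsClosed Z := isClosed_Ici.inter (isClosed_le hHc continuous_const)
  have hZb : BddBelow Z := ⟨a₀, fun k hk => hk.1⟩
  have hcZ : sInf Z ∈ Z := hZc.csInf_mem ⟨k₁, hk₁.le, hk₁H⟩ hZb
  set c := sInf Z with hc
  have hac : a₀ < c := hcZ.1.lt_of_ne fun hac => by
    have := hcZ.2
    rw [← hac] at this
    linarith
  have hbefore : ∀ k, a₀ < k → k < c → 0 < H k := fun k hk hkc => by
    by_contra! hkH
    exact absurd (csInf_le hZb ⟨hk.le, hkH⟩) (not_le.2 hkc)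
  have hleft : ∀ x < c, 0 ≤ H x := fun x hx => by
    rcases le_or_gt x a₀ with hxa | hxa
    · exact hH0 x hxa
    · exact (hbefore x hxa hx).le
  have hHc0 : H c = 0 := by
    refine le_antisymm hcZ.2 (ge_of_tendsto (hHc.continuousAt.tendsto.mono_left
      (nhdsWithin_le_nhds (s := Iio c))) ?_)
    filter_upwards [self_mem_nhdsWithin] with x hx using hleft x hx
  have hslope : leftSlope μ ν c < s := by
    have h1 : leftSlope μ ν c ≤ s := by
      refine le_of_hasDerivWithinAt_Iio (hasDerivWithinAt_diffFn_left h.left_mem h.right_mem c)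
        (sub_one_lt c) fun y _ hy => ?_
      have h2 := hleft y hy
      simp only [hH] at hHc0 h2
      rw [← hD]; linarith
    refine h1.lt_of_ne fun h2 => hS c hac (h2 ▸ hpos) fun k hk => ?_
    have h3 : 0 ≤ H k := hk.eq_or_lt.elim (fun h => by rw [h, hHc0]) (hleft k)
    simp only [hH] at hHc0 h3
    rw [h2, ← hD]; linarith
  refine ⟨c, hac, fun k hk hkc => ?_, fun k hck => ?_, hslope⟩
  · have := hbefore k hk hkc
    simp only [hH] at this
    linarith
  · by_contra! hk
    have h1 : ∀ x ≤ k, (D b - s * b) + s * x ≤ D x := fun x hx => by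
      refine h.le_diffFn_of_le hS hac.le hpos (fun x hx => ?_) ?_ hx
      · have h3 : 0 ≤ H x := hx.eq_or_lt.elim (fun h => by rw [h, hHc0]) (hleft x)
        simp only [hH] at h3
        linarith
      · linarith
    have h2 := le_of_hasDerivWithinAt_Ioi (σ := s)
      (hasDerivWithinAt_diffFn_right h.left_mem h.right_mem h.noAtoms c) hck fun y _ hy => by
        have h3 := h1 y hy.le
        simp only [hH] at hHc0
        rw [← hD]; linarith
    have h3 : 0 ≤ μ.real {c} := measureReal_nonneg
    linarith

end Tangents

lemma real_Iio_pos_of_lowerEnd_lt {χ : Measure ℝ} [IsFiniteMeasure χ] {b : ℝ}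
    (h : lowerEnd χ < (b : EReal)) : 0 < χ.real (Iio b) := by
  obtain ⟨_, ⟨x, hx, rfl⟩, hxb⟩ := sInf_lt_iff.1 h
  have h1 : 0 < χ (Iio b) := by
    rw [Measure.mem_support_iff_forall] at hx
    exact hx _ (Iio_mem_nhds (EReal.coe_lt_coe_iff.1 hxb))
  exact ENNReal.toReal_pos h1.ne' (measure_ne_top _ _)

end InjMart

theorem mainTheorem5 : InjMart.classSLC ⊆ InjMart.classR := by
  open InjMart in
  rintro ⟨μ, ν⟩ ⟨h, u₀, hu₀, hum, hA, hB⟩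
  dsimp only at h hum hA hB
  have := h.left_mem.finite
  have := h.right_mem.finite
  obtain ⟨a₀, hgr, ha, hlim, hgt⟩ := h.exists_turningPoint hu₀ hum hA hB
  have hle : μ.restrict (Iio a₀) ≤ ν.restrict (Iio a₀) := hgr.1
  have hS : ∀ g, a₀ < g → 0 < leftSlope μ ν g → ¬ LeftSupported μ ν g := by
    intro g hg hpos
    -- A positive slope at `g` means that `g` is not above all of `μ`.
    refine h.not_leftSupported hu₀ hB (hgt g hg) ?_
    have h1 := real_Iio_le_univ (χ := ν) g
    rw [← h.real_univ_eq] at h1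
    simp only [leftSlope] at hpos
    linarith
  have hpos : ∀ x ≤ a₀, 0 < ν.real (Iio x) → 0 < leftSlope μ ν x := fun x hx hνx =>
    h.leftSlope_pos (leftSupported_of_restrict_le h.left_mem h.right_mem hle hx) hνx
      ((real_Iio_mono hx).trans_lt (ha ▸ hum))
  refine ⟨h, a₀, hgr, ?_, ⟨leftSlope μ ν a₀, ?_, fun k hk _ => ?_⟩, fun b hb1 hb2 => ?_⟩
  · rw [ha]; exact hlim
  · exact hasDerivWithinAt_diffFn_left h.left_mem h.right_mem a₀
  · refine h.diffFn_lt_tangent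
      (leftSupported_of_restrict_le h.left_mem h.right_mem hle le_rfl) (hpos a₀ le_rfl ?_) hS hk
    exact (ha.symm ▸ hu₀).trans_le (real_le_of_restrict_le hle measurableSet_Iio le_rfl)
  · obtain ⟨hba, hlt⟩ := h.leftSlope_lt_of_lt_equalityEnd hle hb2
    obtain ⟨c, hc, h1, h2, h3⟩ := h.exists_crossing hle hS hba hlt
      (hpos b hba.le (real_Iio_pos_of_lowerEnd_lt hb1))
    exact ⟨leftSlope μ ν b,
      hasDerivAt_diffFn h.left_mem h.right_mem h.noAtoms (h.measure_singleton_eq_zero hle hba),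
      c, hc, h1, h2, leftSlope μ ν c,
      hasDerivWithinAt_diffFn_left h.left_mem h.right_mem c, h3⟩
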